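/- Let $G$ be a finite simple cubic (3-regular) plane graph, not necessarily connected, such that every facial walk (boundary walk of a face, an edge traversed in both directions being counted twice) has length $3$ or $6$; for connected $G$ this means that every face has size $3$ or $6$. Here a plane graph is given combinatorially, by a rotation system (a cyclic order of the edges at each vertex) for which every connected component has genus $0$, that is, embeds in the sphere. Then $G$ is distance-two four-colorable: there is a map $c : V(G) \to \{1,2,3,4\}$ such that, for each vertex $v$, the colors of $v$ and of all its neighbors are pairwise distinct (equivalently, any two distinct vertices at distance at most two have different colors). -/

import Mathlib

/-- A rotation system (combinatorial embedding in an oriented closed surface) of a simple graph: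
a permutation of the darts (edges with a direction) which, for every vertex `v`, permutes the
darts leaving `v` in a single cycle, namely their anticlockwise order around `v`. -/
structure RotationSystem {V : Type*} (G : SimpleGraph V) where
  /-- the next dart in the anticlockwise order around the same initial vertex -/
  next : Equiv.Perm G.Dart
  fst_next : ∀ d : G.Dart, (next d).fst = d.fst
  sameCycle : ∀ d e : G.Dart, d.fst = e.fst → next.SameCycle d e

namespace RotationSystem

variable {V : Type*} {G : SimpleGraph V}

/-- The face-tracing permutation of the darts: after walking along a dart `d` from `u` to `v`,
continue with the dart leaving `v` that follows the reverse of `d` in the rotation at `v`. -/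
def faceNext (R : RotationSystem G) : Equiv.Perm G.Dart :=
  (Function.Involutive.toPerm SimpleGraph.Dart.symm SimpleGraph.Dart.symm_involutive).trans R.next

/-- The faces of a rotation system, given by their boundary walks (facial walks): the orbits of
the face-tracing permutation. -/
def Face (R : RotationSystem G) : Type _ :=
  Quotient (Equiv.Perm.SameCycle.setoid R.faceNext)

/-- The size of a face: the length of its boundary walk. An edge that is traversed
in both directions by the walk (a bridge) counts twice. -/
noncomputable def faceSize (R : RotationSystem G) (F : R.Face) : ℕ :=
  Nat.card {d : G.Dart // (Quotient.mk (Equiv.Perm.SameCycle.setoid R.faceNext) d : R.Face) = F}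

/-- A rotation system of a finite graph is plane if the surface in which it embeds each connected
component is the sphere. Each component has Euler characteristic at most `2`, so
this says that the Euler characteristics `|V| - |E| + |F|` of the components add up to twice the
number of components. An isolated vertex has no dart, and its embedding in the sphere has one
face (with a trivial boundary walk), which is counted separately. -/
def IsPlane (R : RotationSystem G) : Prop :=
  Nat.card V + (Nat.card R.Face + Nat.card {v : V // G.IsIsolated v}) =
    Nat.card G.edgeSet + 2 * Nat.card G.ConnectedComponent

end RotationSystem

/-- A distance-two coloring: every vertex and all its neighbors have pairwise distinct colors. -/
def IsDistanceTwoColoring {V α : Type*} (G : SimpleGraph V) (c : V → α) : Prop :=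
  ∀ v : V, Set.InjOn c (insert v (G.neighborSet v))

/-- `G` is distance-two `r`-colorable. -/
def DistanceTwoColorable {V : Type*} (G : SimpleGraph V) (r : ℕ) : Prop :=
  ∃ c : V → Fin r, IsDistanceTwoColoring G c

/-! The colors are the elements of (ℤ/2)², obtained by integrating twice over the sphere. The tool
is `IsPlane.exists_potential`: an antisymmetric dart function with zero sum along every facial walk
is a potential difference.

Number the darts at each vertex modulo 3 in rotation order. The difference of the numbers at the two
ends of an edge sums to the face size modulo 3 along a facial walk, hence to 0. Shifting the numbers
at each vertex by the potential makes the two ends of every edge agree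
(`IsPlane.exists_edgeColoring`).

The resulting edge colors run cyclically through ℤ/3 along every facial walk. Label them by the
three nonzero elements of (ℤ/2)², whose sum is 0. These labels again integrate to a vertex function
(`IsPlane.exists_potential_of_edgeColoring`). The neighbors of a vertex then differ from it by three
distinct nonzero elements, so all four colors are distinct. -/

theorem Equiv.Perm.SameCycle.eq_of_forall_apply_eq {α β : Type*} {σ : Equiv.Perm β} {φ : β → α}
    (h : ∀ b, φ (σ b) = φ b) {b c : β} (hbc : σ.SameCycle b c) : φ b = φ c := by
  obtain ⟨n, rfl⟩ := hbc
  induction n with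
  | zero => simp
  | succ n ih => rw [ih, add_comm, zpow_one_add, Equiv.Perm.mul_apply, h]
  | pred n ih =>
    rw [ih, ← h ((σ ^ (-(n : ℤ) - 1)) b), ← Equiv.Perm.mul_apply, ← zpow_one_add, add_sub_cancel]

/-! ### Sums over darts and functions constant on components -/

namespace SimpleGraph

variable {V : Type*} {G : SimpleGraph V}

theorem IsRegularOfDegree.exists_dart_fst_eq [G.LocallyFinite] {n : ℕ}
    (h : G.IsRegularOfDegree (n + 1)) (v : V) : ∃ d : G.Dart, d.fst = v := by
  obtain ⟨w, hw⟩ := (G.degree_pos_iff_exists_adj v).1 (by rw [h v]; exact n.succ_pos)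
  exact ⟨⟨(v, w), hw⟩, rfl⟩

/-- Summing over darts is summing over the two directions of every edge. -/
theorem sum_dart_eq_sum_edgeSet {M : Type*} [AddCommMonoid M] [Fintype G.Dart] [Fintype G.edgeSet]
    (o : G.edgeSet → G.Dart) (ho : ∀ e, (o e).edge = e) (φ : G.Dart → M) :
    ∑ d, φ d = ∑ e, (φ (o e) + φ (o e).symm) := by
  classical
  have hbij : Function.Bijective
      (fun p : G.edgeSet × Bool => if p.2 then o p.1 else (o p.1).symm) := by
    constructor
    · rintro ⟨e, b⟩ ⟨e', b'⟩ h
      have he : e = e' := by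
        have := congrArg Dart.edge h
        apply Subtype.ext
        cases b <;> cases b' <;> simpa [ho] using this
      subst he
      have h1 := (o e).symm_ne
      cases b <;> cases b' <;> simp_all [eq_comm]
    · intro d
      rcases (dart_edge_eq_iff d (o ⟨d.edge, d.edge_mem⟩)).1 (ho ⟨d.edge, d.edge_mem⟩).symm with h | h
      · exact ⟨(⟨d.edge, d.edge_mem⟩, true), by simpa using h.symm⟩
      · exact ⟨(⟨d.edge, d.edge_mem⟩, false), by simpa using h.symm⟩
  rw [← hbij.sum_comp φ, Fintype.sum_prod_type]
  simp

theorem eq_of_reachable_of_forall_dart {α : Type*} {g : V → α}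
    (hg : ∀ d : G.Dart, g d.snd = g d.fst) {u v : V} (h : G.Reachable u v) : g u = g v := by
  obtain ⟨p⟩ := h
  induction p with
  | nil => rfl
  | cons hadj _ ih => exact (hg ⟨(_, _), hadj⟩).symm.trans ih

/-- A linear space of vertex functions that are constant along edges has dimension at most
the number of connected components. -/
theorem finrank_le_card_connectedComponent {K W : Type*} [Field K] [AddCommGroup W] [Module K W]
    [Finite V] (Φ : W →ₗ[K] (V → K)) (hΦ : Function.Injective Φ)
    (hconst : ∀ w, ∀ d : G.Dart, Φ w d.snd = Φ w d.fst) :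
    Module.finrank K W ≤ Nat.card G.ConnectedComponent := by
  classical
  have : Fintype G.ConnectedComponent := Fintype.ofFinite _
  let Ψ : W →ₗ[K] (G.ConnectedComponent → K) := (LinearMap.funLeft K K Quot.out).comp Φ
  have hΨ : Function.Injective Ψ := by
    intro w w' h
    apply hΦ
    funext v
    have hv : G.Reachable (Quot.out (G.connectedComponentMk v)) v :=
      ConnectedComponent.exact (Quot.out_eq _)
    rw [← eq_of_reachable_of_forall_dart (hconst w) hv,
      ← eq_of_reachable_of_forall_dart (hconst w') hv]
    exact congrFun h (G.connectedComponentMk v)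
  simpa [Nat.card_eq_fintype_card] using LinearMap.finrank_le_finrank_of_injective hΨ

end SimpleGraph

/-! ### Facial walks and vanishing of the first cohomology -/

namespace RotationSystem

variable {V : Type*} {G : SimpleGraph V}

/-- The face on the boundary walk of which a dart lies. -/
def face (R : RotationSystem G) (d : G.Dart) : R.Face :=
  Quotient.mk (Equiv.Perm.SameCycle.setoid R.faceNext) d

theorem faceNext_apply (R : RotationSystem G) (d : G.Dart) : R.faceNext d = R.next d.symm := rfl

theorem fst_faceNext (R : RotationSystem G) (d : G.Dart) : (R.faceNext d).fst = d.snd :=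
  R.fst_next d.symm

theorem face_faceNext (R : RotationSystem G) (d : G.Dart) : R.face (R.faceNext d) = R.face d :=
  Quotient.sound (s := Equiv.Perm.SameCycle.setoid R.faceNext)
    (Equiv.Perm.sameCycle_apply_left.2 (Equiv.Perm.SameCycle.refl _ _))

theorem face_next (R : RotationSystem G) (d : G.Dart) : R.face (R.next d) = R.face d.symm := by
  rw [← R.face_faceNext d.symm, faceNext_apply, SimpleGraph.Dart.symm_symm]

/-- Face tracing permutes the darts of each face. This is what makes sums of differences along a
facial walk telescope. -/
theorem sum_face_comp_faceNext [Fintype G.Dart] {M : Type*} [AddCommMonoid M] (R : RotationSystem G)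
    [DecidableEq R.Face] (F : R.Face) (φ : G.Dart → M) :
    ∑ d, (if R.face d = F then φ (R.faceNext d) else 0) = ∑ d, if R.face d = F then φ d else 0 := by
  rw [← Equiv.sum_comp R.faceNext (fun d => if R.face d = F then φ d else 0)]
  simp only [face_faceNext]

theorem sum_face_one [Fintype G.Dart] {M : Type*} [AddCommMonoidWithOne M] (R : RotationSystem G)
    [DecidableEq R.Face] (F : R.Face) :
    ∑ d, (if R.face d = F then (1 : M) else 0) = R.faceSize F := by
  classical
  rw [Finset.sum_boole, ← Fintype.card_subtype, ← Nat.card_eq_fintype_card]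
  rfl

theorem eq_of_fst_eq {α : Type*} (R : RotationSystem G) {φ : G.Dart → α}
    (h : ∀ d, φ (R.next d) = φ d) {d e : G.Dart} (hde : d.fst = e.fst) : φ d = φ e :=
  (R.sameCycle d e hde).eq_of_forall_apply_eq h

/-- On a plane graph, the first cohomology vanishes: a flow-like function on the darts whose sum
along every facial walk is zero is a potential difference. -/
theorem IsPlane.exists_potential [Finite V] {R : RotationSystem G} (hR : R.IsPlane)
    (hdart : ∀ v, ∃ d : G.Dart, d.fst = v) [Fintype G.Dart] [DecidableEq R.Face]
    {K : Type*} [Field K] (ω : G.Dart → K) (hω : ∀ d, ω d.symm = -ω d)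
    (hface : ∀ F, ∑ d, (if R.face d = F then ω d else 0) = 0) :
    ∃ g : V → K, ∀ d : G.Dart, g d.snd - g d.fst = ω d := by
  classical
  have : Fintype V := Fintype.ofFinite V
  have : Fintype G.edgeSet := Fintype.ofFinite _
  have : Finite R.Face := Quotient.finite _
  have : Fintype R.Face := Fintype.ofFinite _
  have ho : ∀ e : G.edgeSet, ∃ d : G.Dart, d.edge = e := by
    rintro ⟨e, he⟩
    induction e with
    | h u v => exact ⟨⟨(u, v), he⟩, rfl⟩
  choose o ho using ho
  choose b hb using hdart
  have hdir : ∀ d : G.Dart, ∃ e, d = o e ∨ d = (o e).symm := fun d =>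
    ⟨⟨d.edge, d.edge_mem⟩, (SimpleGraph.dart_edge_eq_iff _ _).1 (ho ⟨d.edge, d.edge_mem⟩).symm⟩
  -- `δ` is the coboundary of the graph and `M` below that of its dual, for the orientation `o`; the
  -- transpose of `M` sums along facial walks.
  let δ : (V → K) →ₗ[K] (G.edgeSet → K) :=
    LinearMap.funLeft K K (fun e => (o e).snd) - LinearMap.funLeft K K (fun e => (o e).fst)
  have hδ : ∀ g e, δ g e = g (o e).snd - g (o e).fst := fun _ _ => rfl
  obtain ⟨M, hMdef⟩ : ∃ M : Matrix G.edgeSet R.Face K, ∀ e F, M e F =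
      (if R.face (o e) = F then 1 else 0) - (if R.face (o e).symm = F then 1 else 0) :=
    ⟨_, fun _ _ => rfl⟩
  have hM : ∀ h e, M.mulVecLin h e = h (R.face (o e)) - h (R.face (o e).symm) := by
    intro h e
    simp [hMdef, Matrix.mulVec, dotProduct, sub_mul, Finset.sum_sub_distrib]
  have hMt : ∀ η : G.Dart → K, (∀ d, η d.symm = -η d) → ∀ F,
      M.transpose.mulVecLin (fun e => η (o e)) F = ∑ d, if R.face d = F then η d else 0 := by
    intro η hη F
    rw [SimpleGraph.sum_dart_eq_sum_edgeSet o ho]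
    simp only [Matrix.mulVecLin_apply, Matrix.mulVec, dotProduct, Matrix.transpose_apply, hMdef,
      hη]
    refine Finset.sum_congr rfl fun e _ => ?_
    split_ifs <;> ring
  have hle : LinearMap.range δ ≤ LinearMap.ker M.transpose.mulVecLin := by
    rintro _ ⟨g, rfl⟩
    rw [LinearMap.mem_ker]
    funext F
    have h := hMt (fun d => g d.snd - g d.fst) (fun d => by simp) F
    refine h.trans ?_
    have h2 := R.sum_face_comp_faceNext F (fun d => g d.fst)
    simp only [fst_faceNext, ← Finset.sum_filter] at h2
    rw [← Finset.sum_filter, Finset.sum_sub_distrib, h2, sub_self]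
    rfl
  have h0 : Module.finrank K (LinearMap.ker δ) ≤ Nat.card G.ConnectedComponent := by
    refine SimpleGraph.finrank_le_card_connectedComponent (G := G) (LinearMap.ker δ).subtype
      Subtype.val_injective ?_
    rintro ⟨g, hg⟩ d
    obtain ⟨e, rfl | rfl⟩ := hdir d
    · exact sub_eq_zero.1 (congrFun hg e)
    · exact (sub_eq_zero.1 (congrFun hg e)).symm
  have h1 : Module.finrank K (LinearMap.ker M.mulVecLin) ≤ Nat.card G.ConnectedComponent := by
    have hsymm : ∀ h ∈ LinearMap.ker M.mulVecLin, ∀ d, h (R.face d.symm) = h (R.face d) := by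
      intro h hh d
      have hh' : ∀ e, h (R.face (o e)) = h (R.face (o e).symm) := fun e =>
        sub_eq_zero.1 ((hM h e).symm.trans (congrFun hh e))
      obtain ⟨e, rfl | rfl⟩ := hdir d
      · exact (hh' e).symm
      · simpa using hh' e
    -- Consecutive faces around a vertex share an edge, so `h` has a single value there and descends
    -- to a function of the vertices.
    have hvert : ∀ h ∈ LinearMap.ker M.mulVecLin, ∀ d, h (R.face (b d.fst)) = h (R.face d) :=
      fun h hh d => R.eq_of_fst_eq (φ := fun d => h (R.face d))
        (fun d => by simp only [face_next, hsymm h hh]) (hb _)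
    refine SimpleGraph.finrank_le_card_connectedComponent (G := G)
      ((LinearMap.funLeft K K (fun v => R.face (b v))).comp (LinearMap.ker M.mulVecLin).subtype)
      ?_ ?_
    · rintro ⟨h, hh⟩ ⟨h', hh'⟩ heq
      apply Subtype.ext
      funext F
      obtain ⟨d, rfl⟩ : ∃ d, R.face d = F := Quotient.exists_rep F
      exact (hvert h hh d).symm.trans ((congrFun heq d.fst).trans (hvert h' hh' d))
    · rintro ⟨h, hh⟩ d
      exact (hvert h hh d.symm).trans ((hsymm h hh d).trans (hvert h hh d).symm)
  have hiso : Nat.card {v : V // G.IsIsolated v} = 0 := by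
    rw [Nat.card_eq_zero]
    refine Or.inl ⟨fun ⟨v, hv⟩ => hv (w := (b v).snd) ?_⟩
    have := (b v).adj
    rwa [hb v] at this
  have hEuler := hR
  rw [IsPlane, hiso, Nat.card_eq_fintype_card, Nat.card_eq_fintype_card (α := R.Face),
    Nat.card_eq_fintype_card (α := G.edgeSet)] at hEuler
  have r0 := LinearMap.finrank_range_add_finrank_ker δ
  have r1 := LinearMap.finrank_range_add_finrank_ker M.mulVecLin
  have r2 := LinearMap.finrank_range_add_finrank_ker M.transpose.mulVecLin
  have r3 : Module.finrank K (LinearMap.range M.transpose.mulVecLin) =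
    Module.finrank K (LinearMap.range M.mulVecLin) := Matrix.rank_transpose M
  rw [Module.finrank_fintype_fun_eq_card] at r0 r1 r2
  -- With c components, `δ` has rank at least |V| - c and `M` at least |F| - c. By Euler's formula
  -- the kernel of the transpose has dimension at most |E| - |F| + c = |V| - c.
  have heq : LinearMap.range δ = LinearMap.ker M.transpose.mulVecLin :=
    Submodule.eq_of_le_of_finrank_le hle (by omega)
  have hmem : (fun e => ω (o e)) ∈ LinearMap.range δ := by
    rw [heq, LinearMap.mem_ker]
    funext F
    exact (hMt ω hω F).trans (hface F)
  obtain ⟨g, hg⟩ := hmem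
  refine ⟨g, fun d => ?_⟩
  obtain ⟨e, rfl | rfl⟩ := hdir d
  · exact congrFun hg e
  · rw [hω, ← congrFun hg e, hδ, neg_sub]
    rfl

/-! ### Edge colorings from the rotation -/

theorem minimalPeriod_next [Fintype V] [DecidableRel G.Adj] (R : RotationSystem G) (d : G.Dart) :
    Function.minimalPeriod (R.next • ·) d = G.degree d.fst := by
  classical
  have : Fintype (MulAction.orbit (Subgroup.zpowers R.next) d) := Fintype.ofFinite _
  rw [MulAction.minimalPeriod_eq_card, ← G.dart_fst_fiber_card_eq_degree, ← Fintype.card_subtype]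
  refine Fintype.card_congr (Equiv.subtypeEquivRight fun e => ?_)
  constructor
  · rintro ⟨⟨_, n, rfl⟩, rfl⟩
    exact (Equiv.Perm.SameCycle.eq_of_forall_apply_eq (φ := fun d : G.Dart => d.fst) R.fst_next
      ⟨n, rfl⟩).symm
  · intro h
    obtain ⟨n, hn⟩ := R.sameCycle d e h.symm
    exact ⟨⟨_, n, rfl⟩, hn⟩

/-- In a cubic graph, the darts can be numbered modulo 3 so that the number increases by 1
in the rotation at every vertex. -/
theorem exists_position [Fintype V] [DecidableRel G.Adj] (hcubic : G.IsRegularOfDegree 3)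
    (R : RotationSystem G) : ∃ k : G.Dart → ZMod 3, ∀ d, k (R.next d) = k d + 1 := by
  let s := Equiv.Perm.SameCycle.setoid R.next
  have hr : ∀ d, ∃ n : ℤ, (R.next ^ n) (Quotient.out (Quotient.mk s d)) = d := fun d =>
    Quotient.exact (s := s) (Quotient.out_eq _)
  choose n hn using hr
  refine ⟨fun d => n d, fun d => ?_⟩
  have hq : Quotient.mk s (R.next d) = Quotient.mk s d :=
    Quotient.sound (s := s) (Equiv.Perm.sameCycle_apply_left.2 (Equiv.Perm.SameCycle.refl _ _))
  have h1 := hn (R.next d)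
  rw [hq] at h1
  set b := Quotient.out (Quotient.mk s d)
  -- Exponents leading from `b` to the same dart agree modulo the period, which is the degree 3.
  have h2 : (R.next ^ (n (R.next d) - (n d + 1))) • b = b := by
    have h3 : (R.next ^ (n d + 1)) b = R.next d := by
      rw [add_comm, zpow_one_add, Equiv.Perm.mul_apply, hn d]
    rw [Equiv.Perm.smul_def, sub_eq_neg_add, zpow_add, Equiv.Perm.mul_apply, h1, ← h3, zpow_neg,
      ← Equiv.Perm.mul_apply, inv_mul_cancel, Equiv.Perm.one_apply]
  rw [MulAction.zpow_smul_eq_iff_minimalPeriod_dvd, minimalPeriod_next, hcubic] at h2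
  have h4 := (ZMod.intCast_zmod_eq_zero_iff_dvd _ 3).2 h2
  push_cast at h4
  linear_combination h4

/-- The number of rotation steps from `d` to `e` is 0 modulo 3, and three steps return to the start.
-/
theorem eq_of_position_eq [Fintype V] [DecidableRel G.Adj] (hcubic : G.IsRegularOfDegree 3)
    (R : RotationSystem G) {k : G.Dart → ZMod 3} (hk : ∀ d, k (R.next d) = k d + 1)
    {d e : G.Dart} (hde : d.fst = e.fst) (h : k d = k e) : d = e := by
  obtain ⟨n, hn⟩ := R.sameCycle d e hde
  have hk' : ∀ n : ℤ, k ((R.next ^ n) d) = k d + n := by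
    intro n
    induction n with
    | zero => simp
    | succ n ih =>
      rw [add_comm, zpow_one_add, Equiv.Perm.mul_apply, hk, ih]
      push_cast
      ring
    | pred n ih =>
      have h := hk ((R.next ^ (-(n : ℤ) - 1)) d)
      rw [← Equiv.Perm.mul_apply, ← zpow_one_add, add_sub_cancel, ih] at h
      push_cast at h ⊢
      linear_combination -h
  have h0 : ((n : ℤ) : ZMod 3) = 0 := by
    have := hk' n
    rw [hn, ← h] at this
    simpa using this
  rw [ZMod.intCast_zmod_eq_zero_iff_dvd] at h0
  have h1 : (R.next ^ n) • d = d := by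
    rw [MulAction.zpow_smul_eq_iff_minimalPeriod_dvd, minimalPeriod_next, hcubic]
    exact h0
  exact h1.symm.trans hn

/-- A cubic plane graph whose face sizes are divisible by 3 has a 3-edge-coloring in which the
colors appear in the same cyclic order around all vertices. -/
theorem IsPlane.exists_edgeColoring [Fintype V] [DecidableRel G.Adj]
    (hcubic : G.IsRegularOfDegree 3) {R : RotationSystem G} (hR : R.IsPlane)
    (hface : ∀ F : R.Face, 3 ∣ R.faceSize F) :
    ∃ f : G.Dart → ZMod 3, (∀ d, f (R.next d) = f d + 1) ∧ ∀ d, f d.symm = f d := by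
  classical
  obtain ⟨k, hk⟩ := exists_position hcubic R
  have : Fact (Nat.Prime 3) := ⟨Nat.prime_three⟩
  obtain ⟨g, hg⟩ := hR.exists_potential hcubic.exists_dart_fst_eq (fun d => k d - k d.symm) (by simp) (by
    intro F
    -- The difference telescopes along the walk, and the ones add up to the face size.
    have hk' : ∀ d, k d - k d.symm = k d - k (R.faceNext d) + 1 := fun d => by
      rw [faceNext_apply, hk]; ring
    have h1 := R.sum_face_comp_faceNext F k
    have h2 := R.sum_face_one (M := ZMod 3) F
    rw [(ZMod.natCast_eq_zero_iff _ _).2 (hface F)] at h2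
    simp only [hk', ← Finset.sum_filter, Finset.sum_add_distrib, Finset.sum_sub_distrib] at h1 h2 ⊢
    rw [h1, h2, sub_self, add_zero])
  refine ⟨fun d => g d.fst + k d, fun d => ?_, fun d => ?_⟩
  · change g _ + k _ = g _ + k _ + 1
    rw [R.fst_next, hk, add_assoc]
  · have := hg d
    change g d.snd + k d.symm = g d.fst + k d
    linear_combination this

/-- A `2`-torsion labelling of three cyclically ordered edge colors with sum zero integrates to
the vertices. -/
theorem IsPlane.exists_potential_of_edgeColoring [Finite V] [Fintype G.Dart] {R : RotationSystem G}
    (hR : R.IsPlane) (hdart : ∀ v, ∃ d : G.Dart, d.fst = v)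
    {f : G.Dart → ZMod 3} (hnext : ∀ d, f (R.next d) = f d + 1) (hsymm : ∀ d, f d.symm = f d)
    (α : ZMod 3 → ZMod 2) (hα : ∀ x, α x + α (x + 1) + α (x + 1 + 1) = 0) :
    ∃ g : V → ZMod 2, ∀ d : G.Dart, g d.snd = g d.fst + α (f d) := by
  classical
  obtain ⟨g, hg⟩ := hR.exists_potential hdart (fun d => α (f d))
    (by simp [hsymm, CharTwo.neg_eq]) (by
    intro F
    have hf : ∀ d, f (R.faceNext d) = f d + 1 := fun d => by rw [faceNext_apply, hnext, hsymm]
    have h1 := R.sum_face_comp_faceNext F (fun d => α (f d))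
    have h2 := R.sum_face_comp_faceNext F (fun d => α (f d + 1))
    simp only [hf, ← Finset.sum_filter] at h1 h2 ⊢
    -- By shift invariance the three summands of `hα` have the same sum S over the face, so 3S = 0,
    -- and S = 0 in characteristic 2.
    have h3 := Finset.sum_congr (rfl : Finset.univ.filter (fun d => R.face d = F) = _)
      (fun d _ => hα (f d))
    simp only [Finset.sum_add_distrib, Finset.sum_const_zero, h2, h1] at h3
    simpa [CharTwo.add_self_eq_zero] using h3)
  exact ⟨g, fun d => by rw [← hg d, add_sub_cancel]⟩

end RotationSystem

/-! ### The four vertex colors -/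

/-- The edge colors 0, 1, 2 are labelled (1,0), (0,1), (1,1). -/
theorem eq_of_color_eq : ∀ x y : ZMod 3, (if x = 1 then (0 : ZMod 2) else 1) =
    (if y = 1 then 0 else 1) → (if x = 0 then (0 : ZMod 2) else 1) = (if y = 0 then 0 else 1) →
    x = y := by
  decide

theorem color_ne_zero : ∀ x : ZMod 3, (if x = 1 then (0 : ZMod 2) else 1) ≠ 0 ∨
    (if x = 0 then (0 : ZMod 2) else 1) ≠ 0 := by
  decide

theorem corollary5p2 {V : Type*} [Fintype V] (G : SimpleGraph V) [DecidableRel G.Adj]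
    (hcubic : G.IsRegularOfDegree 3)
    (R : RotationSystem G) (hplane : R.IsPlane)
    (hface : ∀ F : R.Face, R.faceSize F = 3 ∨ R.faceSize F = 6) :
    DistanceTwoColorable G 4 := by
  classical
  have hdart := hcubic.exists_dart_fst_eq
  obtain ⟨f, hnext, hsymm⟩ := hplane.exists_edgeColoring hcubic fun F => by
    rcases hface F with h | h <;> simp [h]
  obtain ⟨g, hg⟩ := hplane.exists_potential_of_edgeColoring hdart hnext hsymm
    (fun x => if x = 1 then 0 else 1) (by decide)
  obtain ⟨h, hh⟩ := hplane.exists_potential_of_edgeColoring hdart hnext hsymm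
    (fun x => if x = 0 then 0 else 1) (by decide)
  have hcard : Fintype.card (ZMod 2 × ZMod 2) = 4 := by simp
  refine ⟨fun v => Fintype.equivFinOfCardEq hcard (g v, h v), fun v => ?_⟩
  have hne : ∀ w, G.Adj v w → (g w, h w) ≠ (g v, h v) := by
    intro w hw heq
    have h1 := hg ⟨(v, w), hw⟩
    have h2 := hh ⟨(v, w), hw⟩
    rw [Prod.mk.injEq] at heq
    simp only [heq.1, heq.2, left_eq_add] at h1 h2
    rcases color_ne_zero (f ⟨(v, w), hw⟩) with h3 | h3
    exacts [h3 h1, h3 h2]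
  rintro x hx y hy hxy
  replace hxy := (Fintype.equivFinOfCardEq hcard).injective hxy
  rcases hx with rfl | hx <;> rcases hy with rfl | hy
  · rfl
  · exact absurd hxy.symm (hne y hy)
  · exact absurd hxy (hne x hx)
  · rw [Prod.mk.injEq] at hxy
    have h1 := (hg ⟨(v, x), hx⟩).symm.trans (hxy.1.trans (hg ⟨(v, y), hy⟩))
    have h2 := (hh ⟨(v, x), hx⟩).symm.trans (hxy.2.trans (hh ⟨(v, y), hy⟩))
    exact congrArg (fun d : G.Dart => d.snd)
      (R.eq_of_position_eq hcubic hnext (d := ⟨(v, x), hx⟩) (e := ⟨(v, y), hy⟩) rfl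
        (eq_of_color_eq _ _ (add_left_cancel h1) (add_left_cancel h2)))
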